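/- Let $I$ be a bounded nondegenerate interval, and let $D(I)$ be its dyadic lattice: $I$ itself, its left and right halves, their left and right halves, and so on. Write $\langle\phi\rangle_J=\frac1{|J|}\int_J\phi\,dt$. For real $x_1,x_2,x_3$ with $x_1^2\le x_2$ and $0<x_3\le1$ put $$ \mathbf B(x_1,x_2,x_3):=\sup\frac1{|I|}\sum_{J\in D(I)}|\langle\phi\rangle_J|^2\,\alpha_J, $$ where the supremum is taken over all real-valued $\phi\in L^2(I)$ and all families of nonnegative numbers $(\alpha_J)_{J\in D(I)}$ such that $$ \langle\phi\rangle_I=x_1,\qquad \langle\phi^2\rangle_I=x_2,\qquad \frac1{|I|}\sum_{J\in D(I)}\alpha_J=x_3,\qquad \sum_{\ell\in D(J)}\alpha_\ell\le|J|\quad\text{for all }J\in D(I). $$ If $x_2>0$, then the equation $$ \frac{x_1^2}{x_2}=\left[\frac{1-2a(1-x_3)}{1-2a}\right]^2\frac{1-4a}{1-4a(1-x_3)} $$ has exactly one solution $a=a(x)$ in $[0,\frac14]$, and $$ \mathbf B(x_1,x_2,x_3)=\frac{x_3x_2}{[1-2a]^2\,[1-4a(1-x_3)]}. $$ If $x_2=0$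 (so that $x_1=0$), then $\mathbf B(x_1,x_2,x_3)=0$. In particular $\mathbf B$ is finite and does not depend on $I$. -/

import Mathlib

open scoped ENNReal
open MeasureTheory

/-- The left half (`false`) or the right half (`true`) of the interval with endpoints
`I.1 < I.2`. -/
noncomputable def dyadicSon (I : ℝ × ℝ) : Bool → ℝ × ℝ
  | false => (I.1, (I.1 + I.2) / 2)
  | true => ((I.1 + I.2) / 2, I.2)

/-- The dyadic lattice `D(I)`, indexed by finite words: the empty word gives `I`, and a word
`b :: σ` gives the interval with address `σ` inside the half `b` of `I`. For a nondegenerate `I`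
distinct words give distinct intervals, and the members of `D(J)`, for `J` with address `σ`, are
exactly the intervals with addresses `σ ++ τ`. -/
noncomputable def dyadicInterval : ℝ × ℝ → List Bool → ℝ × ℝ
  | I, [] => I
  | I, b :: σ => dyadicInterval (dyadicSon I b) σ

/-- The length `|J|`. -/
def intervalLength (J : ℝ × ℝ) : ℝ := J.2 - J.1

/-- The average of `φ` over the interval `J`, with respect to Lebesgue measure. -/
noncomputable def intervalMean (φ : ℝ → ℝ) (J : ℝ × ℝ) : ℝ :=
  ⨍ t in Set.Ioc J.1 J.2, φ t

/-- `φ` and the weights `α` compete at the point `(x₁, x₂, x₃)` over the interval `I`. -/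
structure CarlesonAdmissible (I : ℝ × ℝ) (x₁ x₂ x₃ : ℝ)
    (φ : ℝ → ℝ) (α : List Bool → ℝ) : Prop where
  memLp : MemLp φ 2 (volume.restrict (Set.Ioc I.1 I.2))
  mean_eq : intervalMean φ I = x₁
  mean_sq_eq : intervalMean (fun t => φ t ^ 2) I = x₂
  nonneg : ∀ σ, 0 ≤ α σ
  hasSum : HasSum α (intervalLength I * x₃)
  /-- The Carleson condition with constant `1`. (The series converges, being a subseries of the
  convergent nonnegative series in `hasSum`.) -/
  carleson : ∀ σ, ∑' τ, α (σ ++ τ) ≤ intervalLength (dyadicInterval I σ)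

/-- The normalized Carleson sum `(1/|I|) ∑_{J ∈ D(I)} ⟨φ⟩_J² α_J`, as a sum of nonnegative
terms with values in `[0, ∞]`. -/
noncomputable def carlesonSum (I : ℝ × ℝ) (φ : ℝ → ℝ) (α : List Bool → ℝ) : ℝ≥0∞ :=
  (∑' σ, ENNReal.ofReal (|intervalMean φ (dyadicInterval I σ)| ^ 2 * α σ)) /
    ENNReal.ofReal (intervalLength I)

/-- The Bellman function of the dyadic Carleson embedding theorem, computed on `I`. -/
noncomputable def carlesonBellman (I : ℝ × ℝ) (x₁ x₂ x₃ : ℝ) : ℝ≥0∞ :=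
  sSup {v | ∃ φ : ℝ → ℝ, ∃ α : List Bool → ℝ,
    CarlesonAdmissible I x₁ x₂ x₃ φ α ∧ v = carlesonSum I φ α}

/-- The equation that `a` has to solve at the point `(x₁, x₂, x₃)`. -/
def CarlesonCubic (x₁ x₂ x₃ a : ℝ) : Prop :=
  x₁ ^ 2 / x₂ = ((1 - 2 * a * (1 - x₃)) / (1 - 2 * a)) ^ 2 *
    ((1 - 4 * a) / (1 - 4 * a * (1 - x₃)))

/-! ### Sums over the binary tree -/

/-! Write `h = 2a`. The upper bound is a Bellman induction with the explicit functions
`carlesonMajorant h`, `0 < h ≤ 1/2`. Each satisfies `carlesonMajorant_main_inequality`, a midpoint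
concavity that also pays for the weight at the top interval. Iterating it down the tree
(`carleson_truncated_le`) bounds every Carleson sum. The equation for `a` says that the majorant is
stationary in `h`, and there its value is the claimed one.

The lower bound needs no explicit extremizers. Attainable points are closed under scaling and under
gluing two competitors with an extra top weight (`CarlesonAttains.glue`), hence, up to an
arbitrarily small loss, under convex combinations (`CarlesonAttains.mix`). On the face `x₃ = 1` a
small move returning to the same point gives an inequality for the supremum that forces the sharp
value (`exists_carlesonAttains_top`). Points with `x₃ < 1` lie on segments from that face to
constant functions without weights (`exists_carlesonAttains`). The endpoints `h = 0` and `h = 1/2`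
are handled by limits. -/

theorem hasSum_list_bool {M : Type*} [AddCommMonoid M] [TopologicalSpace M] [ContinuousAdd M]
    {f : List Bool → M} {a b : M} (ha : HasSum (fun σ => f (false :: σ)) a)
    (hb : HasSum (fun σ => f (true :: σ)) b) : HasSum f (f [] + (a + b)) := by
  -- `f` splits into three functions, supported on the empty word and on the words with each first
  -- letter.
  have key : ∀ (c : Bool) (s : M), HasSum (fun σ => f (c :: σ)) s →
      HasSum (fun σ : List Bool => if σ.head? = some c then f σ else 0) s := by
    intro c s hs
    have hinj : Function.Injective (fun σ : List Bool => c :: σ) := fun _ _ h => by simpa using h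
    rw [← hinj.hasSum_iff]
    · simpa [Function.comp_def] using hs
    · intro σ hσ
      rcases σ with _ | ⟨d, τ⟩
      · simp
      · have : d ≠ c := by
          rintro rfl
          exact hσ ⟨τ, rfl⟩
        simp [this]
  have h0 : HasSum (fun σ : List Bool => if σ = [] then f [] else 0) (f []) := by
    simpa using hasSum_ite_eq ([] : List Bool) (f [])
  convert h0.add ((key false a ha).add (key true b hb)) using 1
  funext σ
  rcases σ with _ | ⟨_ | _, τ⟩ <;> simp

theorem Summable.tsum_list_bool {α : List Bool → ℝ} (h : Summable α) :
    ∑' σ, α σ = α [] + (∑' σ, α (false :: σ) + ∑' σ, α (true :: σ)) :=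
  (hasSum_list_bool (h.comp_injective (List.cons_injective (a := false))).hasSum
    (h.comp_injective (List.cons_injective (a := true))).hasSum).tsum_eq

theorem ENNReal.tsum_list_bool (f : List Bool → ℝ≥0∞) :
    ∑' σ, f σ = f [] + (∑' σ, f (false :: σ) + ∑' σ, f (true :: σ)) :=
  (hasSum_list_bool ENNReal.summable.hasSum ENNReal.summable.hasSum).tsum_eq

theorem ENNReal.tsum_list_le_of_truncated {f : List Bool → ℝ≥0∞} {c : ℝ≥0∞}
    (h : ∀ N : ℕ, ∑' σ, (if σ.length < N then f σ else 0) ≤ c) : ∑' σ, f σ ≤ c := by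
  rw [ENNReal.tsum_eq_iSup_sum]
  refine iSup_le fun s => ?_
  refine le_trans ?_ (h (s.sup List.length + 1))
  refine le_trans (le_of_eq (Finset.sum_congr rfl fun σ hσ => ?_)) (ENNReal.sum_le_tsum s)
  have : σ.length ≤ s.sup List.length := Finset.le_sup hσ
  simp [Nat.lt_succ_of_le this]

/-! ### Dyadic intervals and averages -/

theorem intervalLength_pos {I : ℝ × ℝ} (hI : I.1 < I.2) : 0 < intervalLength I := by
  simpa [intervalLength] using hI

theorem dyadicSon_lt {I : ℝ × ℝ} (hI : I.1 < I.2) (b : Bool) :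
    (dyadicSon I b).1 < (dyadicSon I b).2 := by
  cases b <;> simp only [dyadicSon] <;> linarith

theorem intervalLength_dyadicSon (I : ℝ × ℝ) (b : Bool) :
    intervalLength (dyadicSon I b) = intervalLength I / 2 := by
  cases b <;> simp only [dyadicSon, intervalLength] <;> ring

theorem dyadicSon_subset {I : ℝ × ℝ} (hI : I.1 < I.2) (b : Bool) :
    Set.Ioc (dyadicSon I b).1 (dyadicSon I b).2 ⊆ Set.Ioc I.1 I.2 := by
  cases b <;> simp only [dyadicSon] <;> apply Set.Ioc_subset_Ioc <;> linarith

theorem dyadicInterval_lt {I : ℝ × ℝ} (hI : I.1 < I.2) (σ : List Bool) :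
    (dyadicInterval I σ).1 < (dyadicInterval I σ).2 := by
  induction σ generalizing I with
  | nil => exact hI
  | cons b σ ih => exact ih (dyadicSon_lt hI b)

theorem dyadicInterval_subset {I : ℝ × ℝ} (hI : I.1 < I.2) (σ : List Bool) :
    Set.Ioc (dyadicInterval I σ).1 (dyadicInterval I σ).2 ⊆ Set.Ioc I.1 I.2 := by
  induction σ generalizing I with
  | nil => exact subset_rfl
  | cons b σ ih => exact (ih (dyadicSon_lt hI b)).trans (dyadicSon_subset hI b)

theorem intervalMean_eq {J : ℝ × ℝ} (hJ : J.1 < J.2) (φ : ℝ → ℝ) :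
    intervalMean φ J = (∫ t in Set.Ioc J.1 J.2, φ t) / intervalLength J := by
  rw [intervalMean, setAverage_eq, intervalLength, Measure.real, Real.volume_Ioc,
    ENNReal.toReal_ofReal (by linarith), smul_eq_mul, inv_mul_eq_div]

theorem intervalMean_congr {J : ℝ × ℝ} {φ ψ : ℝ → ℝ} (h : Set.EqOn φ ψ (Set.Ioc J.1 J.2)) :
    intervalMean φ J = intervalMean ψ J :=
  setAverage_congr_fun measurableSet_Ioc (Filter.Eventually.of_forall fun _ ht => h ht)

theorem intervalMean_const {J : ℝ × ℝ} (hJ : J.1 < J.2) (c : ℝ) :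
    intervalMean (fun _ => c) J = c := by
  have := intervalLength_pos hJ
  rw [intervalMean_eq hJ, setIntegral_const, Measure.real, Real.volume_Ioc,
    ENNReal.toReal_ofReal (by linarith), smul_eq_mul, ← intervalLength]
  field_simp

theorem intervalMean_const_mul {J : ℝ × ℝ} (hJ : J.1 < J.2) (c : ℝ) (φ : ℝ → ℝ) :
    intervalMean (fun t => c * φ t) J = c * intervalMean φ J := by
  rw [intervalMean_eq hJ, intervalMean_eq hJ, integral_const_mul, mul_div_assoc]

theorem intervalMean_eq_add_div_two {I : ℝ × ℝ} (hI : I.1 < I.2) {φ : ℝ → ℝ}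
    (hφ : IntegrableOn φ (Set.Ioc I.1 I.2)) :
    intervalMean φ I =
      (intervalMean φ (dyadicSon I false) + intervalMean φ (dyadicSon I true)) / 2 := by
  have h0 := intervalLength_pos hI
  rw [intervalMean_eq hI, intervalMean_eq (dyadicSon_lt hI _), intervalMean_eq (dyadicSon_lt hI _),
    intervalLength_dyadicSon, intervalLength_dyadicSon]
  have hu : Set.Ioc I.1 I.2 = Set.Ioc (dyadicSon I false).1 (dyadicSon I false).2 ∪
      Set.Ioc (dyadicSon I true).1 (dyadicSon I true).2 := by
    simp only [dyadicSon]
    rw [Set.Ioc_union_Ioc_eq_Ioc] <;> linarith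
  rw [hu, setIntegral_union (by simp only [dyadicSon]; exact Set.Ioc_disjoint_Ioc_of_le le_rfl)
    measurableSet_Ioc (hφ.mono_set (dyadicSon_subset hI _))
    (hφ.mono_set (dyadicSon_subset hI _))]
  field_simp

theorem memLp_restrict_of_subset {φ : ℝ → ℝ} {s t : Set ℝ} (hst : s ⊆ t)
    (h : MemLp φ 2 (volume.restrict t)) : MemLp φ 2 (volume.restrict s) :=
  h.mono_measure (Measure.restrict_mono_set _ hst)

theorem intervalMean_sq_le {J : ℝ × ℝ} (hJ : J.1 < J.2) {φ : ℝ → ℝ}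
    (hφ : MemLp φ 2 (volume.restrict (Set.Ioc J.1 J.2))) :
    intervalMean φ J ^ 2 ≤ intervalMean (fun t => φ t ^ 2) J := by
  have hl := intervalLength_pos hJ
  have hv : volume (Set.Ioc J.1 J.2) ≠ 0 := by
    rw [Real.volume_Ioc]; simpa using hJ
  have : NeZero (volume.restrict (Set.Ioc J.1 J.2)) :=
    ⟨by rwa [Ne, Measure.restrict_eq_zero]⟩
  exact (even_two.convexOn_pow (𝕜 := ℝ)).map_average_le (continuous_pow 2).continuousOn isClosed_univ
    (Filter.Eventually.of_forall fun _ => Set.mem_univ _)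
    (hφ.integrable (by norm_num)) hφ.integrable_sq

/-! ### The upper bound -/

/-- The value at `(x₁, x₂, x₃)` of the supersolution with parameter `h`; it is affine in `x₂` and
homogeneous of degree two in `x₁`. -/
noncomputable def carlesonMajorant (h x₁ x₂ x₃ : ℝ) : ℝ :=
  x₂ / (h * (1 - h)) - x₁ ^ 2 / (h * (1 - h * (1 - x₃)))

theorem carlesonMajorant_nonneg {h x₁ x₂ x₃ : ℝ} (h0 : 0 < h) (h1 : h ≤ 1 / 2)
    (hx : x₁ ^ 2 ≤ x₂) (hx₃ : 0 ≤ x₃) : 0 ≤ carlesonMajorant h x₁ x₂ x₃ := by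
  have hd : 0 < h * (1 - h) := by nlinarith
  have : x₁ ^ 2 / (h * (1 - h * (1 - x₃))) ≤ x₂ / (h * (1 - h)) := by
    apply div_le_div₀ ((sq_nonneg _).trans hx) hx hd
    nlinarith [mul_nonneg (mul_nonneg h0.le h0.le) hx₃]
  exact sub_nonneg.2 this

/-- Joint convexity of `p ^ 2 / u`, in its homogeneous form; it gives the concavity of the majorant
in `(x₁, x₃)`. -/
theorem add_sq_div_add_le {p q u v : ℝ} (hu : 0 < u) (hv : 0 < v) :
    (p + q) ^ 2 / (u + v) ≤ p ^ 2 / u + q ^ 2 / v := by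
  rw [div_add_div _ _ hu.ne' hv.ne', div_le_div_iff₀ (by positivity) (by positivity)]
  nlinarith [mul_nonneg (mul_pos hu hv).le (sq_nonneg (p * v - q * u)),
    sq_nonneg (p * v - q * u)]

/-- The right side equals `s ^ 2 * α / (D * (D + h * α))`, and both factors of the denominator are
at most `1`. So raising `x₃` by `α` raises the majorant enough to pay for the top term. -/
theorem sq_div_sub_sq_div_ge {h s D α : ℝ} (h0 : 0 < h) (hD : 0 < D) (hα : 0 ≤ α)
    (hDα : D + h * α ≤ 1) : s ^ 2 * α ≤ s ^ 2 / (h * D) - s ^ 2 / (h * (D + h * α)) := by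
  have hD' : 0 < D + h * α := by positivity
  have e : s ^ 2 / (h * D) - s ^ 2 / (h * (D + h * α)) = s ^ 2 * α / (D * (D + h * α)) := by
    field_simp
    ring
  rw [e, le_div_iff₀ (by positivity)]
  have : D * (D + h * α) ≤ 1 := by nlinarith [mul_nonneg h0.le hα]
  nlinarith [mul_nonneg (sq_nonneg s) hα]

theorem carlesonMajorant_main_inequality {h p q P R u v α : ℝ} (h0 : 0 < h) (h1 : h ≤ 1 / 2)
    (hu : 0 ≤ u) (hv : 0 ≤ v) (hα : 0 ≤ α) (h3 : (u + v) / 2 + α ≤ 1) :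
    ((p + q) / 2) ^ 2 * α + (carlesonMajorant h p P u + carlesonMajorant h q R v) / 2 ≤
      carlesonMajorant h ((p + q) / 2) ((P + R) / 2) ((u + v) / 2 + α) := by
  have hDu : 0 < 1 - h * (1 - u) := by nlinarith [mul_nonneg h0.le hu]
  have hDv : 0 < 1 - h * (1 - v) := by nlinarith [mul_nonneg h0.le hv]
  have a1 := add_sq_div_add_le (p := p) (q := q) (mul_pos h0 hDu) (mul_pos h0 hDv)
  have a2 := sq_div_sub_sq_div_ge (s := (p + q) / 2) (D := 1 - h * (1 - (u + v) / 2)) h0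
    (by linarith) hα (by nlinarith)
  have e1 : (p + q) ^ 2 / (h * (1 - h * (1 - u)) + h * (1 - h * (1 - v))) / 2 =
      ((p + q) / 2) ^ 2 / (h * (1 - h * (1 - (u + v) / 2))) := by
    have : 0 < 1 - h * (1 - (u + v) / 2) := by linarith
    have e : h * (1 - h * (1 - u)) + h * (1 - h * (1 - v)) =
      2 * (h * (1 - h * (1 - (u + v) / 2))) := by ring
    rw [e]
    field_simp
  have e2 : 1 - h * (1 - (u + v) / 2) + h * α = 1 - h * (1 - ((u + v) / 2 + α)) := by ring
  rw [e2] at a2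
  unfold carlesonMajorant
  have e3 : (P + R) / 2 / (h * (1 - h)) = (P / (h * (1 - h)) + R / (h * (1 - h))) / 2 := by ring
  rw [e3]
  linarith

/-- Truncating to the first `N` generations makes induction possible: the main inequality peels off
the root, and the two subtrees are the same problem on the halves. -/
theorem carleson_truncated_le {h : ℝ} (h0 : 0 < h) (h1 : h ≤ 1 / 2) (N : ℕ) {I : ℝ × ℝ}
    (hI : I.1 < I.2) {φ : ℝ → ℝ} {α : List Bool → ℝ}
    (hφ : MemLp φ 2 (volume.restrict (Set.Ioc I.1 I.2))) (hα : ∀ σ, 0 ≤ α σ) (hs : Summable α)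
    (hc : ∀ σ, ∑' τ, α (σ ++ τ) ≤ intervalLength (dyadicInterval I σ)) :
    ∑' σ : List Bool, (if σ.length < N then
        ENNReal.ofReal (|intervalMean φ (dyadicInterval I σ)| ^ 2 * α σ) else 0) ≤
      ENNReal.ofReal (intervalLength I * carlesonMajorant h (intervalMean φ I)
        (intervalMean (fun t => φ t ^ 2) I) ((∑' σ, α σ) / intervalLength I)) := by
  induction N generalizing I α with
  | zero => simp
  | succ N ih =>
    have hl := intervalLength_pos hI
    have hsb : ∀ b, Summable fun σ => α (b :: σ) := fun b => hs.comp_injective List.cons_injective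
    have hφb : ∀ b, MemLp φ 2
        (volume.restrict (Set.Ioc (dyadicSon I b).1 (dyadicSon I b).2)) := fun b =>
      memLp_restrict_of_subset (dyadicSon_subset hI b) hφ
    have ihb : ∀ b, _ := fun b => ih (dyadicSon_lt hI b) (hφb b) (fun σ => hα (b :: σ)) (hsb b)
      fun σ => hc (b :: σ)
    have hnn : ∀ b, 0 ≤ (∑' σ, α (b :: σ)) / intervalLength (dyadicSon I b) := fun b =>
      div_nonneg (tsum_nonneg fun σ => hα _) (intervalLength_pos (dyadicSon_lt hI b)).le
    have hF : ∀ b, 0 ≤ carlesonMajorant h (intervalMean φ (dyadicSon I b))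
        (intervalMean (fun t => φ t ^ 2) (dyadicSon I b))
        ((∑' σ, α (b :: σ)) / intervalLength (dyadicSon I b)) := fun b =>
      carlesonMajorant_nonneg h0 h1 (intervalMean_sq_le (dyadicSon_lt hI b) (hφb b)) (hnn b)
    have hx3 : (∑' σ, α σ) / intervalLength I =
        ((∑' σ, α (false :: σ)) / intervalLength (dyadicSon I false) +
          (∑' σ, α (true :: σ)) / intervalLength (dyadicSon I true)) / 2 +
          α [] / intervalLength I := by
      rw [hs.tsum_list_bool, intervalLength_dyadicSon, intervalLength_dyadicSon]
      field_simp
      ring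
    have hle : (∑' σ, α σ) / intervalLength I ≤ 1 := (div_le_one hl).2 (hc [])
    rw [hx3] at hle
    have main := carlesonMajorant_main_inequality (p := intervalMean φ (dyadicSon I false))
      (q := intervalMean φ (dyadicSon I true))
      (P := intervalMean (fun t => φ t ^ 2) (dyadicSon I false))
      (R := intervalMean (fun t => φ t ^ 2) (dyadicSon I true)) h0 h1 (hnn false) (hnn true)
      (div_nonneg (hα []) hl.le) hle
    rw [← hx3, ← intervalMean_eq_add_div_two hI (hφ.integrable (by norm_num)),
      ← intervalMean_eq_add_div_two hI hφ.integrable_sq] at main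
    rw [ENNReal.tsum_list_bool]
    simp only [List.length_nil, Nat.zero_lt_succ, if_true, List.length_cons, Nat.succ_lt_succ_iff,
      dyadicInterval, sq_abs]
    have ih0 := ihb false
    have ih1 := ihb true
    simp only [sq_abs] at ih0 ih1
    refine (add_le_add le_rfl (add_le_add ih0 ih1)).trans ?_
    have hlb : ∀ b, 0 ≤ intervalLength (dyadicSon I b) := fun b =>
      (intervalLength_pos (dyadicSon_lt hI b)).le
    rw [← ENNReal.ofReal_add (mul_nonneg (hlb _) (hF _)) (mul_nonneg (hlb _) (hF _)),
      ← ENNReal.ofReal_add (mul_nonneg (sq_nonneg _) (hα _))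
        (add_nonneg (mul_nonneg (hlb _) (hF _)) (mul_nonneg (hlb _) (hF _)))]
    apply ENNReal.ofReal_le_ofReal
    have e := mul_le_mul_of_nonneg_left main hl.le
    refine le_trans (le_of_eq ?_) e
    rw [intervalLength_dyadicSon I false, intervalLength_dyadicSon I true]
    field_simp

theorem CarlesonAdmissible.carlesonSum_le {I : ℝ × ℝ} (hI : I.1 < I.2) {x₁ x₂ x₃ : ℝ}
    {φ : ℝ → ℝ} {α : List Bool → ℝ} (H : CarlesonAdmissible I x₁ x₂ x₃ φ α) {h : ℝ} (h0 : 0 < h)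
    (h1 : h ≤ 1 / 2) :
    carlesonSum I φ α ≤ ENNReal.ofReal (carlesonMajorant h x₁ x₂ x₃) := by
  have hl := intervalLength_pos hI
  have := ENNReal.tsum_list_le_of_truncated fun N =>
    carleson_truncated_le h0 h1 N hI H.memLp H.nonneg H.hasSum.summable H.carleson
  rw [H.mean_eq, H.mean_sq_eq, H.hasSum.tsum_eq, mul_div_cancel_left₀ _ hl.ne',
    ENNReal.ofReal_mul hl.le] at this
  exact ENNReal.div_le_of_le_mul' this

theorem carlesonBellman_le_majorant {I : ℝ × ℝ} (hI : I.1 < I.2) {x₁ x₂ x₃ h : ℝ} (h0 : 0 < h)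
    (h1 : h ≤ 1 / 2) :
    carlesonBellman I x₁ x₂ x₃ ≤ ENNReal.ofReal (carlesonMajorant h x₁ x₂ x₃) := by
  refine sSup_le ?_
  rintro v ⟨φ, α, H, rfl⟩
  exact H.carlesonSum_le hI h0 h1

/-! ### The lower bound -/

/-- The number `v ≥ 0` is a lower bound for some Carleson sum at `(x₁, x₂, x₃)`, over every
interval. -/
def CarlesonAttains (x₁ x₂ x₃ v : ℝ) : Prop :=
  0 ≤ v ∧ ∀ I : ℝ × ℝ, I.1 < I.2 → ∃ φ α,
    CarlesonAdmissible I x₁ x₂ x₃ φ α ∧ ENNReal.ofReal v ≤ carlesonSum I φ α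

theorem CarlesonAttains.le_carlesonBellman {x₁ x₂ x₃ v : ℝ} (h : CarlesonAttains x₁ x₂ x₃ v)
    {I : ℝ × ℝ} (hI : I.1 < I.2) : ENNReal.ofReal v ≤ carlesonBellman I x₁ x₂ x₃ := by
  obtain ⟨φ, α, H, hv⟩ := h.2 I hI
  exact hv.trans (le_sSup ⟨φ, α, H, rfl⟩)

theorem carlesonAttains_const (c : ℝ) : CarlesonAttains c (c ^ 2) 0 0 := by
  refine ⟨le_rfl, fun I hI => ⟨fun _ => c, fun _ => 0, ?_, by simp⟩⟩
  refine ⟨memLp_const c, intervalMean_const hI c, intervalMean_const hI (c ^ 2), fun _ => le_rfl,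
    by simp, fun σ => ?_⟩
  simpa using (intervalLength_pos (dyadicInterval_lt hI σ)).le

theorem CarlesonAttains.scale {x₁ x₂ x₃ v : ℝ} (h : CarlesonAttains x₁ x₂ x₃ v) (c : ℝ) :
    CarlesonAttains (c * x₁) (c ^ 2 * x₂) x₃ (c ^ 2 * v) := by
  refine ⟨mul_nonneg (sq_nonneg c) h.1, fun I hI => ?_⟩
  obtain ⟨φ, α, H, hv⟩ := h.2 I hI
  refine ⟨fun t => c * φ t, α, ⟨H.memLp.const_mul c, ?_, ?_, H.nonneg, H.hasSum, H.carleson⟩, ?_⟩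
  · rw [intervalMean_const_mul hI, H.mean_eq]
  · simp only [mul_pow]
    rw [intervalMean_const_mul hI, H.mean_sq_eq]
  · have e : carlesonSum I (fun t => c * φ t) α =
        ENNReal.ofReal (c ^ 2) * carlesonSum I φ α := by
      unfold carlesonSum
      rw [← mul_div_assoc, ← ENNReal.tsum_mul_left]
      congr 2
      funext σ
      rw [intervalMean_const_mul (dyadicInterval_lt hI σ), ← ENNReal.ofReal_mul (sq_nonneg c),
        sq_abs, sq_abs]
      ring_nf
    rw [e, ENNReal.ofReal_mul (sq_nonneg c)]
    gcongr

/-- The function that agrees with `φ b` on the half `b` of `I`. -/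
noncomputable def dyadicGlue (I : ℝ × ℝ) (φ : Bool → ℝ → ℝ) (t : ℝ) : ℝ :=
  (Set.Ioc (dyadicSon I false).1 (dyadicSon I false).2).indicator (φ false) t +
    (Set.Ioc (dyadicSon I true).1 (dyadicSon I true).2).indicator (φ true) t

theorem dyadicGlue_eqOn (I : ℝ × ℝ) (φ : Bool → ℝ → ℝ) (b : Bool) :
    Set.EqOn (dyadicGlue I φ) (φ b) (Set.Ioc (dyadicSon I b).1 (dyadicSon I b).2) := by
  intro t ht
  cases b
  · have : t ∉ Set.Ioc (dyadicSon I true).1 (dyadicSon I true).2 := fun h' =>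
      absurd h'.1 (not_lt.2 ht.2)
    rw [dyadicGlue, Set.indicator_of_mem ht, Set.indicator_of_notMem this, add_zero]
  · have : t ∉ Set.Ioc (dyadicSon I false).1 (dyadicSon I false).2 := fun h' =>
      absurd ht.1 (not_lt.2 h'.2)
    rw [dyadicGlue, Set.indicator_of_mem ht, Set.indicator_of_notMem this, zero_add]

theorem memLp_dyadicGlue {I : ℝ × ℝ} {φ : Bool → ℝ → ℝ}
    (h : ∀ b, MemLp (φ b) 2 (volume.restrict (Set.Ioc (dyadicSon I b).1 (dyadicSon I b).2))) :
    MemLp (dyadicGlue I φ) 2 volume :=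
  ((memLp_indicator_iff_restrict measurableSet_Ioc).2 (h false)).add
    ((memLp_indicator_iff_restrict measurableSet_Ioc).2 (h true))

/-- The weights that agree with `α b` on the half `b`, with weight `c` at the top. -/
def weightGlue (c : ℝ) (α : Bool → List Bool → ℝ) : List Bool → ℝ
  | [] => c
  | b :: σ => α b σ

theorem CarlesonAttains.glue {p P u v q R w z a : ℝ} (h : CarlesonAttains p P u v)
    (h' : CarlesonAttains q R w z) (ha : 0 ≤ a) (hle : (u + w) / 2 + a ≤ 1) :
    CarlesonAttains ((p + q) / 2) ((P + R) / 2) ((u + w) / 2 + a)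
      ((v + z) / 2 + ((p + q) / 2) ^ 2 * a) := by
  have hv := h.1
  have hz := h'.1
  refine ⟨by positivity, fun I hI => ?_⟩
  have hl := intervalLength_pos hI
  obtain ⟨φ₀, α₀, H₀, hv₀⟩ := h.2 _ (dyadicSon_lt hI false)
  obtain ⟨φ₁, α₁, H₁, hv₁⟩ := h'.2 _ (dyadicSon_lt hI true)
  set φ : Bool → ℝ → ℝ := fun b => bif b then φ₁ else φ₀ with hφ
  set α : Bool → List Bool → ℝ := fun b => bif b then α₁ else α₀ with hα
  set Φ := dyadicGlue I φ with hΦ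
  set A := weightGlue (intervalLength I * a) α with hA
  have hmem : MemLp Φ 2 volume := memLp_dyadicGlue (by rintro (_ | _); exacts [H₀.memLp, H₁.memLp])
  have hI2 : MemLp Φ 2 (volume.restrict (Set.Ioc I.1 I.2)) := hmem.restrict _
  have eqb : ∀ b σ, Set.EqOn Φ (φ b) (Set.Ioc (dyadicInterval (dyadicSon I b) σ).1
      (dyadicInterval (dyadicSon I b) σ).2) := fun b σ =>
    (dyadicGlue_eqOn I φ b).mono (dyadicInterval_subset (dyadicSon_lt hI b) σ)
  have m0 : intervalMean Φ (dyadicSon I false) = p :=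
    (intervalMean_congr (eqb false [])).trans H₀.mean_eq
  have m1 : intervalMean Φ (dyadicSon I true) = q :=
    (intervalMean_congr (eqb true [])).trans H₁.mean_eq
  have s0 : intervalMean (fun t => Φ t ^ 2) (dyadicSon I false) = P :=
    (intervalMean_congr fun t ht => by simp only [eqb false [] ht]; rfl).trans H₀.mean_sq_eq
  have s1 : intervalMean (fun t => Φ t ^ 2) (dyadicSon I true) = R :=
    (intervalMean_congr fun t ht => by simp only [eqb true [] ht]; rfl).trans H₁.mean_sq_eq
  have hmean : intervalMean Φ I = (p + q) / 2 := by
    rw [intervalMean_eq_add_div_two hI (hI2.integrable (by norm_num)), m0, m1]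
  have hsum : HasSum A (intervalLength I * ((u + w) / 2 + a)) := by
    have := hasSum_list_bool (f := A) H₀.hasSum H₁.hasSum
    convert this using 1
    rw [intervalLength_dyadicSon, intervalLength_dyadicSon]
    simp only [hA, weightGlue]
    ring
  refine ⟨Φ, A, ⟨hI2, hmean, ?_, ?_, hsum, ?_⟩, ?_⟩
  · rw [intervalMean_eq_add_div_two hI hI2.integrable_sq, s0, s1]
  · rintro (_ | ⟨_ | _, σ⟩)
    exacts [mul_nonneg hl.le ha, H₀.nonneg σ, H₁.nonneg σ]
  · rintro (_ | ⟨_ | _, σ⟩)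
    · simp only [List.nil_append, dyadicInterval]
      rw [hsum.tsum_eq]
      nlinarith
    exacts [H₀.carleson σ, H₁.carleson σ]
  · unfold carlesonSum at hv₀ hv₁ ⊢
    rw [intervalLength_dyadicSon, ENNReal.le_div_iff_mul_le
      (Or.inl (by simpa using hl)) (Or.inl ENNReal.ofReal_ne_top)] at hv₀ hv₁
    rw [ENNReal.le_div_iff_mul_le (Or.inl (by simpa using hl)) (Or.inl ENNReal.ofReal_ne_top),
      ENNReal.tsum_list_bool]
    have t0 : ∑' σ, ENNReal.ofReal (|intervalMean Φ (dyadicInterval I (false :: σ))| ^ 2 *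
        A (false :: σ)) = ∑' σ, ENNReal.ofReal
          (|intervalMean φ₀ (dyadicInterval (dyadicSon I false) σ)| ^ 2 * α₀ σ) :=
      tsum_congr fun σ => by
        simp only [dyadicInterval]
        rw [intervalMean_congr (eqb false σ)]
        rfl
    have t1 : ∑' σ, ENNReal.ofReal (|intervalMean Φ (dyadicInterval I (true :: σ))| ^ 2 *
        A (true :: σ)) = ∑' σ, ENNReal.ofReal
          (|intervalMean φ₁ (dyadicInterval (dyadicSon I true) σ)| ^ 2 * α₁ σ) :=
      tsum_congr fun σ => by
        simp only [dyadicInterval]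
        rw [intervalMean_congr (eqb true σ)]
        rfl
    rw [t0, t1]
    refine le_trans (le_of_eq ?_) (add_le_add le_rfl (add_le_add hv₀ hv₁))
    simp only [dyadicInterval, hmean, sq_abs, hA, weightGlue]
    rw [← ENNReal.ofReal_mul hv, ← ENNReal.ofReal_mul hz, ← ENNReal.ofReal_mul (by positivity),
      ← ENNReal.ofReal_add (by positivity) (by positivity),
      ← ENNReal.ofReal_add (by positivity) (by positivity)]
    congr 1
    ring

/-- The domain has no empty fibres: take the two values `x₁ ± √(x₂ - x₁ ^ 2)` on the halves and put
all the weight on the top interval. -/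
theorem carlesonAttains_zero {x₁ x₂ x₃ : ℝ} (hx : x₁ ^ 2 ≤ x₂) (h0 : 0 ≤ x₃) (h1 : x₃ ≤ 1) :
    CarlesonAttains x₁ x₂ x₃ 0 := by
  have hs := Real.sq_sqrt (sub_nonneg.2 hx)
  have := (carlesonAttains_const (x₁ + √(x₂ - x₁ ^ 2))).glue
    (carlesonAttains_const (x₁ - √(x₂ - x₁ ^ 2))) h0 (by simpa using h1)
  refine ⟨le_rfl, fun I hI => ?_⟩
  obtain ⟨φ, α, H, -⟩ := this.2 I hI
  refine ⟨φ, α, ?_, by simp⟩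
  convert H using 1
  · ring
  · linear_combination -hs
  · ring

theorem CarlesonAttains.le_one {x₁ x₂ x₃ v : ℝ} (h : CarlesonAttains x₁ x₂ x₃ v) : x₃ ≤ 1 := by
  obtain ⟨φ, α, H, -⟩ := h.2 (0, 1) (by norm_num)
  have := H.carleson []
  simp only [List.nil_append, dyadicInterval] at this
  rw [H.hasSum.tsum_eq] at this
  simpa [intervalLength] using this

/-- An a priori bound, which makes the supremum in `exists_carlesonAttains_top` finite. -/
theorem CarlesonAttains.le_majorant {x₁ x₂ x₃ v : ℝ} (h : CarlesonAttains x₁ x₂ x₃ v)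
    (hx : x₁ ^ 2 ≤ x₂) (hx₃ : 0 ≤ x₃) : v ≤ carlesonMajorant (1 / 2) x₁ x₂ x₃ := by
  have := (h.le_carlesonBellman (I := (0, 1)) (by norm_num)).trans
    (carlesonBellman_le_majorant (by norm_num) (by norm_num) (le_refl (1 / 2 : ℝ)))
  exact (ENNReal.ofReal_le_ofReal_iff
    (carlesonMajorant_nonneg (by norm_num) le_rfl hx hx₃)).1 this

/-- Each binary digit of `j / 2 ^ n` is one gluing without top weight, with one of the two given
competitors. -/
theorem CarlesonAttains.mix_dyadic {p P u v q R w z : ℝ} (h : CarlesonAttains p P u v)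
    (h' : CarlesonAttains q R w z) (n j : ℕ) (hj : j ≤ 2 ^ n) :
    CarlesonAttains (q + j / 2 ^ n * (p - q)) (R + j / 2 ^ n * (P - R)) (w + j / 2 ^ n * (u - w))
      (z + j / 2 ^ n * (v - z)) := by
  have hu := h.le_one
  have hw := h'.le_one
  induction n generalizing j with
  | zero =>
    obtain rfl | rfl : j = 0 ∨ j = 1 := by simp at hj; omega
    · simpa using h'
    · simpa using h
  | succ n ih =>
    rcases le_total j (2 ^ n) with hjn | hjn
    · have hi := ih j hjn
      have := hi.glue h' le_rfl (by linarith [hi.le_one])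
      convert this using 1 <;> · rw [pow_succ]; field_simp; ring
    · obtain ⟨k, rfl⟩ := Nat.exists_eq_add_of_le hjn
      have hi := ih k (by rw [pow_succ] at hj; omega)
      have := hi.glue h le_rfl (by linarith [hi.le_one])
      convert this using 1 <;> · push_cast; rw [pow_succ]; field_simp; ring

theorem exists_dyadic_between {s t : ℝ} (hs : 0 ≤ s) (hst : s < t) :
    ∃ n j : ℕ, s ≤ (j : ℝ) / 2 ^ n ∧ (j : ℝ) / 2 ^ n < t := by
  obtain ⟨n, hn⟩ := exists_pow_lt_of_lt_one (sub_pos.2 hst) (by norm_num : (1 / 2 : ℝ) < 1)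
  refine ⟨n, ⌈s * 2 ^ n⌉₊, ?_, ?_⟩
  · rw [le_div_iff₀ (by positivity)]
    exact Nat.le_ceil _
  · rw [div_lt_iff₀ (by positivity)]
    have h1 := Nat.ceil_lt_add_one (a := s * 2 ^ n) (by positivity)
    rw [one_div, inv_pow, inv_lt_iff_one_lt_mul₀ (by positivity)] at hn
    linarith

/-- A dyadic fraction `d` in `[s, t)` of the interval carries copies of the first competitor; the
rest carries one filler competitor that corrects the averages and whose sum is discarded. -/
theorem CarlesonAttains.mix {p P u v q R w s t : ℝ} (h : CarlesonAttains p P u v)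
    (hp : p ^ 2 ≤ P) (hu : 0 ≤ u) (hq : q ^ 2 ≤ R) (hw : 0 ≤ w) (hw1 : w ≤ 1)
    (hs : 0 ≤ s) (hst : s < t) (ht : t ≤ 1) :
    CarlesonAttains (q + t * (p - q)) (R + t * (P - R)) (w + t * (u - w)) (s * v) := by
  obtain ⟨n, j, h1, h2⟩ := exists_dyadic_between hs hst
  set d : ℝ := (j : ℝ) / 2 ^ n with hd
  have hd1 : d < 1 := h2.trans_le ht
  have hj : j ≤ 2 ^ n := by
    rw [hd, div_lt_one (by positivity)] at hd1
    exact_mod_cast hd1.le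
  have hd0 : 0 < 1 - d := by linarith
  -- Solves `d + (1 - d) * r = t`.
  set r : ℝ := (t - d) / (1 - d) with hr
  have hr0 : 0 ≤ r := div_nonneg (by linarith) hd0.le
  have hr1 : r ≤ 1 := (div_le_one hd0).2 (by linarith)
  have hrd : r * (1 - d) = t - d := div_mul_cancel₀ _ hd0.ne'
  have hy : CarlesonAttains (q + r * (p - q)) (R + r * (P - R)) (w + r * (u - w)) 0 := by
    have h1r : 0 ≤ 1 - r := by linarith
    apply carlesonAttains_zero
    · nlinarith [mul_nonneg (mul_nonneg hr0 h1r) (sq_nonneg (p - q)),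
        mul_nonneg hr0 (sub_nonneg.2 hp), mul_nonneg h1r (sub_nonneg.2 hq)]
    · nlinarith [mul_nonneg hr0 hu, mul_nonneg h1r hw]
    · nlinarith [mul_nonneg hr0 (sub_nonneg.2 h.le_one), mul_nonneg h1r (sub_nonneg.2 hw1)]
  have := h.mix_dyadic hy n j hj
  rw [← hd] at this
  have hsv : s * v ≤ d * v := mul_le_mul_of_nonneg_right h1 h.1
  refine ⟨mul_nonneg hs h.1, fun I hI => ?_⟩
  obtain ⟨φ, α, H, hv⟩ := this.2 I hI
  refine ⟨φ, α, ?_, (ENNReal.ofReal_le_ofReal (by simpa using hsv)).trans hv⟩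
  convert H using 1
  · linear_combination (-(p - q)) * hrd
  · linear_combination (-(P - R)) * hrd
  · linear_combination (-(u - w)) * hrd

/-- The supremum `m` at this point satisfies, to first order in `e`, `m ≥ (1 - e) * (1 + 2 * e * h)
* m + e * x₁ ^ 2`, whence `m * (1 - 2 * h) ≥ x₁ ^ 2` as `e → 0`. -/
theorem exists_carlesonAttains_top {x₁ x₂ h θ : ℝ} (hx₁ : x₁ ≠ 0) (h0 : 0 ≤ h) (h1 : h < 1 / 2)
    (E : x₂ * (1 - 2 * h) = x₁ ^ 2 * (1 - h) ^ 2) (hθ : θ < 1) :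
    ∃ v, θ * (x₁ ^ 2 / (1 - 2 * h)) ≤ v ∧ CarlesonAttains x₁ x₂ 1 v := by
  have hx2 : 0 < x₁ ^ 2 := by positivity
  have hh : 0 < 1 - 2 * h := by linarith
  have hx : x₁ ^ 2 ≤ x₂ := by nlinarith [mul_nonneg hx2.le (sq_nonneg h)]
  have hx20 : 0 ≤ x₂ := hx2.le.trans hx
  set S : Set ℝ := {v | CarlesonAttains x₁ x₂ 1 v} with hS
  have hne : S.Nonempty := ⟨0, carlesonAttains_zero hx zero_le_one le_rfl⟩
  have hbdd : BddAbove S := ⟨carlesonMajorant (1 / 2) x₁ x₂ 1, fun v hv =>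
    CarlesonAttains.le_majorant hv hx zero_le_one⟩
  set m := sSup S with hm
  have hm0 : 0 ≤ m := le_csSup hbdd (carlesonAttains_zero hx zero_le_one le_rfl)
  have step : ∀ e : ℝ, 0 < e → e ≤ 1 / 4 →
      x₁ ^ 2 * (1 - e * h) ^ 2 ≤ m * (1 - 2 * h + e * (1 + h ^ 2)) := by
    intro e he he1
    have hd : 0 < 1 - e * h := by nlinarith
    set l : ℝ := 1 / (1 - e * h) with hl
    have hl0 : 0 < l := by positivity
    have hle : l * (1 - e * h) = 1 := by rw [hl]; field_simp
    have hs : 0 < 1 - e - e ^ 2 := by nlinarith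
    have key : ∀ v ∈ S, (1 - e - e ^ 2) * (l ^ 2 * v) + x₁ ^ 2 * e ≤ m := by
      intro v hv
      have hsc := CarlesonAttains.scale hv l
      -- `l`, `q` and `R` are chosen so that the mixture has coordinates `(x₁, x₂, 1 - e)`. By `E`,
      -- the term `e * h ^ 2` in `R` only moves the second point inside the domain. The loss `e ^ 2`
      -- in `s` is of second order.
      have hmix := hsc.mix (q := x₁ * (1 - h) * l) (R := x₂ * (1 - 2 * h + e * h ^ 2) * l ^ 2)
        (w := 0) (s := 1 - e - e ^ 2) (t := 1 - e)
        (by rw [mul_pow]; exact mul_le_mul_of_nonneg_left hx (sq_nonneg l)) zero_le_one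
        (by
          have : x₁ ^ 2 * (1 - h) ^ 2 ≤ x₂ * (1 - 2 * h + e * h ^ 2) := by
            nlinarith [mul_nonneg hx20 (mul_nonneg he.le (sq_nonneg h))]
          calc (x₁ * (1 - h) * l) ^ 2 = x₁ ^ 2 * (1 - h) ^ 2 * l ^ 2 := by ring
            _ ≤ _ := mul_le_mul_of_nonneg_right this (sq_nonneg l))
        le_rfl zero_le_one hs.le (by nlinarith) (by linarith)
      -- Gluing two copies only adds top weight `e`, which leads back to `x₃ = 1`.
      have hg := hmix.glue hmix he.le (by linarith)
      refine le_csSup hbdd ?_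
      change CarlesonAttains _ _ _ _
      convert hg using 1
      · linear_combination (-x₁) * hle
      · linear_combination (-x₂ * (l * (1 - e * h) + 1)) * hle
      · ring
      · linear_combination (-x₁ ^ 2 * e * (l * (1 - e * h) + 1)) * hle
    have hc : 0 < (1 - e - e ^ 2) * l ^ 2 := by positivity
    have h2 : m ≤ (m - x₁ ^ 2 * e) / ((1 - e - e ^ 2) * l ^ 2) :=
      csSup_le hne fun v hv => by
        rw [le_div_iff₀ hc]
        linarith [key v hv]
    rw [le_div_iff₀ hc] at h2
    have h3 : m * ((1 - e - e ^ 2) * l ^ 2) * (1 - e * h) ^ 2 ≤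
        (m - x₁ ^ 2 * e) * (1 - e * h) ^ 2 := mul_le_mul_of_nonneg_right h2 (sq_nonneg _)
    have h4 : m * ((1 - e - e ^ 2) * l ^ 2) * (1 - e * h) ^ 2 = m * (1 - e - e ^ 2) := by
      linear_combination (m * (1 - e - e ^ 2) * (l * (1 - e * h) + 1)) * hle
    rw [h4] at h3
    refine le_of_mul_le_mul_left ?_ he
    linarith
  have hmle : x₁ ^ 2 ≤ m * (1 - 2 * h) := by
    by_contra! hlt
    set D := x₁ ^ 2 - m * (1 - 2 * h) with hD
    have hD0 : 0 < D := sub_pos.2 hlt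
    set C := m * (1 + h ^ 2) + 2 * h * x₁ ^ 2 with hC
    have hC0 : 0 ≤ C := by positivity
    set e := min (1 / 4) (D / (2 * (C + 1))) with he
    have he0 : 0 < e := lt_min (by norm_num) (by positivity)
    have h1 := step e he0 (min_le_left _ _)
    have h2 : e * (2 * (C + 1)) ≤ D :=
      (le_div_iff₀ (by positivity)).1 (min_le_right _ _)
    nlinarith [mul_nonneg hx2.le (sq_nonneg (e * h)), mul_nonneg he0.le hC0]
  have hV : x₁ ^ 2 / (1 - 2 * h) ≤ m := (div_le_iff₀ hh).2 hmle
  have hV0 : 0 < x₁ ^ 2 / (1 - 2 * h) := by positivity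
  obtain ⟨v, hv, hlt⟩ := exists_lt_of_lt_csSup hne
    (show θ * (x₁ ^ 2 / (1 - 2 * h)) < m by nlinarith)
  exact ⟨v, hlt.le, hv⟩

-- The point divides, in proportion `x₃`, the segment from a constant `k * (1 - h)` with no weights
-- to a point of the top face with first coordinate `k`. One factor `θ` is lost on the top face and
-- one in the mixing.
theorem exists_carlesonAttains {x₁ x₂ x₃ h θ : ℝ} (hx₁ : x₁ ≠ 0) (h0 : 0 ≤ h) (h1 : h < 1 / 2)
    (hx₃ : 0 < x₃) (hx₃' : x₃ ≤ 1)
    (E : x₂ * (1 - 2 * h) * (1 - h * (1 - x₃)) ^ 2 =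
      x₁ ^ 2 * (1 - h) ^ 2 * (1 - 2 * h * (1 - x₃))) (hθ0 : 0 ≤ θ) (hθ : θ < 1) :
    ∃ v, θ ^ 2 * (x₃ * x₂ / ((1 - h) ^ 2 * (1 - 2 * h * (1 - x₃)))) ≤ v ∧
      CarlesonAttains x₁ x₂ x₃ v := by
  have hh : 0 < 1 - 2 * h := by linarith
  have hh' : 0 < 1 - h := by linarith
  have hy : 0 < 1 - h * (1 - x₃) := by nlinarith
  have hy' : 0 < 1 - 2 * h * (1 - x₃) := by nlinarith
  set k : ℝ := x₁ / (1 - h * (1 - x₃)) with hk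
  have hkx : k * (1 - h * (1 - x₃)) = x₁ := div_mul_cancel₀ _ hy.ne'
  have hk0 : k ≠ 0 := div_ne_zero hx₁ hy.ne'
  have E' : x₂ * (1 - 2 * h) = k ^ 2 * (1 - h) ^ 2 * (1 - 2 * h * (1 - x₃)) := by
    rw [← hkx] at E
    have : (1 - h * (1 - x₃)) ^ 2 ≠ 0 := by positivity
    apply mul_right_cancel₀ this
    linear_combination E
  obtain ⟨v, hv, hA⟩ := exists_carlesonAttains_top (x₁ := k)
    (x₂ := k ^ 2 * (1 - h) ^ 2 / (1 - 2 * h)) hk0 h0 h1 (div_mul_cancel₀ _ hh.ne') hθ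
  have hmix := hA.mix (q := k * (1 - h)) (R := k ^ 2 * (1 - h) ^ 2) (w := 0) (s := θ * x₃)
    (t := x₃)
    (by rw [le_div_iff₀ hh]; nlinarith [mul_nonneg (sq_nonneg k) (sq_nonneg h)])
    zero_le_one (by rw [mul_pow]) le_rfl zero_le_one (by positivity) (by nlinarith) hx₃'
  refine ⟨θ * x₃ * v, ?_, ?_⟩
  · have e : x₃ * x₂ / ((1 - h) ^ 2 * (1 - 2 * h * (1 - x₃))) = x₃ * (k ^ 2 / (1 - 2 * h)) := by
      rw [← mul_div_assoc, div_eq_div_iff (by positivity) hh.ne']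
      linear_combination x₃ * E'
    rw [e]
    have := mul_le_mul_of_nonneg_left hv (mul_nonneg hθ0 hx₃.le)
    linarith
  · convert hmix using 1
    · linear_combination -hkx
    · apply mul_right_cancel₀ hh.ne'
      rw [E']
      linear_combination (-x₃) * div_mul_cancel₀ (k ^ 2 * (1 - h) ^ 2) hh.ne'
    · ring

theorem le_carlesonBellman_of_lt {I : ℝ × ℝ} (hI : I.1 < I.2) {x₁ x₂ x₃ h : ℝ} (hx₁ : x₁ ≠ 0)
    (h0 : 0 ≤ h) (h1 : h < 1 / 2) (hx₃ : 0 < x₃) (hx₃' : x₃ ≤ 1)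
    (E : x₂ * (1 - 2 * h) * (1 - h * (1 - x₃)) ^ 2 =
      x₁ ^ 2 * (1 - h) ^ 2 * (1 - 2 * h * (1 - x₃))) :
    ENNReal.ofReal (x₃ * x₂ / ((1 - h) ^ 2 * (1 - 2 * h * (1 - x₃)))) ≤
      carlesonBellman I x₁ x₂ x₃ := by
  set V := x₃ * x₂ / ((1 - h) ^ 2 * (1 - 2 * h * (1 - x₃))) with hV
  have ht : Filter.Tendsto (fun θ : ℝ => ENNReal.ofReal (θ ^ 2 * V)) (nhdsWithin 1 (Set.Iio 1))
      (nhds (ENNReal.ofReal V)) := by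
    have hc : Continuous fun θ : ℝ => ENNReal.ofReal (θ ^ 2 * V) :=
      ENNReal.continuous_ofReal.comp (by fun_prop)
    have := (hc.tendsto 1).mono_left (nhdsWithin_le_nhds (s := Set.Iio 1))
    simpa using this
  refine le_of_tendsto ht ?_
  filter_upwards [Ioo_mem_nhdsLT (show (0 : ℝ) < 1 by norm_num)] with θ hθ
  obtain ⟨v, hv, hA⟩ := exists_carlesonAttains hx₁ h0 h1 hx₃ hx₃' E hθ.1.le hθ.2
  exact (ENNReal.ofReal_le_ofReal hv).trans (hA.le_carlesonBellman hI)

/-- At `x₁ = 0` the parameter is `h = 1/2`, where the top-face construction degenerates. Instead `h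
= θ / 2` is used at mean `√d2`, with `d2` solved from the equation, and the competitor is glued to
its negative. -/
theorem exists_carlesonAttains_zero_mean {x₂ x₃ θ : ℝ} (hx₂ : 0 < x₂) (hx₃ : 0 < x₃)
    (hx₃' : x₃ ≤ 1) (hθ0 : 0 < θ) (hθ : θ < 1) :
    ∃ v, θ ^ 2 * (x₃ * x₂ / ((1 - θ / 2) ^ 2 * (1 - θ * (1 - x₃)))) ≤ v ∧
      CarlesonAttains 0 x₂ x₃ v := by
  have hy : 0 < 1 - θ * (1 - x₃) := by nlinarith
  have hy2 : 0 < 1 - θ / 2 * (1 - x₃) := by nlinarith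
  have hh : 0 < 1 - θ / 2 := by linarith
  have hθ' : 0 < 1 - θ := by linarith
  set d2 : ℝ := x₂ * (1 - θ) * (1 - θ / 2 * (1 - x₃)) ^ 2 /
    ((1 - θ / 2) ^ 2 * (1 - θ * (1 - x₃))) with hd2
  have hd0 : 0 < d2 := by positivity
  have hsq : √d2 ^ 2 = d2 := Real.sq_sqrt hd0.le
  have hd : d2 * ((1 - θ / 2) ^ 2 * (1 - θ * (1 - x₃))) =
      x₂ * (1 - θ) * (1 - θ / 2 * (1 - x₃)) ^ 2 := div_mul_cancel₀ _ (by positivity)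
  have h2 : 2 * (θ / 2) = θ := by ring
  obtain ⟨v, hv, hA⟩ := exists_carlesonAttains (x₁ := √d2) (x₂ := x₂) (h := θ / 2) (θ := θ)
    (Real.sqrt_pos.2 hd0).ne' (by positivity) (by linarith) hx₃ hx₃'
    (by
      rw [hsq, h2]
      linear_combination -hd) hθ0.le hθ
  rw [h2] at hv
  refine ⟨v, hv, ?_⟩
  have := hA.glue (hA.scale (-1)) le_rfl (by linarith)
  convert this using 1 <;> ring

theorem le_carlesonBellman_zero_mean {I : ℝ × ℝ} (hI : I.1 < I.2) {x₂ x₃ : ℝ} (hx₂ : 0 < x₂)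
    (hx₃ : 0 < x₃) (hx₃' : x₃ ≤ 1) : ENNReal.ofReal (4 * x₂) ≤ carlesonBellman I 0 x₂ x₃ := by
  have hden : (1 - (1 : ℝ) / 2) ^ 2 * (1 - 1 * (1 - x₃)) = x₃ / 4 := by ring
  have hr : ContinuousAt (fun θ : ℝ =>
      θ ^ 2 * (x₃ * x₂ / ((1 - θ / 2) ^ 2 * (1 - θ * (1 - x₃))))) 1 := by
    refine ContinuousAt.mul (by fun_prop) (ContinuousAt.div (by fun_prop) (by fun_prop) ?_)
    rw [hden]
    positivity
  have ht : Filter.Tendsto (fun θ : ℝ => ENNReal.ofReal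
      (θ ^ 2 * (x₃ * x₂ / ((1 - θ / 2) ^ 2 * (1 - θ * (1 - x₃))))))
      (nhdsWithin 1 (Set.Iio 1)) (nhds (ENNReal.ofReal (4 * x₂))) := by
    have := ENNReal.tendsto_ofReal (hr.tendsto.mono_left (nhdsWithin_le_nhds (s := Set.Iio 1)))
    rw [hden] at this
    convert this using 3
    field_simp
  refine le_of_tendsto ht ?_
  filter_upwards [Ioo_mem_nhdsLT (show (0 : ℝ) < 1 by norm_num)] with θ hθ
  obtain ⟨v, hv, hA⟩ := exists_carlesonAttains_zero_mean hx₂ hx₃ hx₃' hθ.1 hθ.2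
  exact (ENNReal.ofReal_le_ofReal hv).trans (hA.le_carlesonBellman hI)

/-! ### The upper bound at the optimal parameter -/

theorem carlesonBellman_le_of_pos {I : ℝ × ℝ} (hI : I.1 < I.2) {x₁ x₂ x₃ h : ℝ}
    (h0 : 0 < h) (h1 : h ≤ 1 / 2) (hx₃ : 0 < x₃)
    (E : x₂ * (1 - 2 * h) * (1 - h * (1 - x₃)) ^ 2 =
      x₁ ^ 2 * (1 - h) ^ 2 * (1 - 2 * h * (1 - x₃))) :
    carlesonBellman I x₁ x₂ x₃ ≤
      ENNReal.ofReal (x₃ * x₂ / ((1 - h) ^ 2 * (1 - 2 * h * (1 - x₃)))) := by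
  refine (carlesonBellman_le_majorant hI h0 h1).trans (le_of_eq ?_)
  congr 1
  have hh' : 0 < 1 - h := by linarith
  have hy : 0 < 1 - h * (1 - x₃) := by nlinarith
  have hy' : 0 < 1 - 2 * h * (1 - x₃) := by nlinarith
  -- Once the equation eliminates `x₁ ^ 2`, a factor `h` cancels and the majorant becomes the
  -- claimed value.
  have hx1 : x₁ ^ 2 = x₂ * (1 - 2 * h) * (1 - h * (1 - x₃)) ^ 2 /
      ((1 - h) ^ 2 * (1 - 2 * h * (1 - x₃))) := by
    rw [eq_div_iff (by positivity)]
    linarith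
  have hy'' : 1 - h * 2 * (1 - x₃) ≠ 0 := fun h' => by linarith
  rw [carlesonMajorant, hx1]
  field_simp
  ring

/-- Here the optimal parameter is `h = 0`, where the majorant is singular; for `x₁ ^ 2 = x₂` its two
poles cancel, so `h → 0` is allowed. -/
theorem carlesonBellman_le_of_sq_eq {I : ℝ × ℝ} (hI : I.1 < I.2) {x₁ x₂ x₃ : ℝ}
    (hx₃ : 0 < x₃) (E : x₁ ^ 2 = x₂) :
    carlesonBellman I x₁ x₂ x₃ ≤ ENNReal.ofReal (x₃ * x₂) := by
  have hr : ContinuousAt (fun h : ℝ => x₃ * x₂ / ((1 - h) * (1 - h * (1 - x₃)))) 0 :=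
    ContinuousAt.div (by fun_prop) (by fun_prop) (by norm_num)
  have ht : Filter.Tendsto (fun h : ℝ => ENNReal.ofReal
      (x₃ * x₂ / ((1 - h) * (1 - h * (1 - x₃)))))
      (nhdsWithin 0 (Set.Ioi 0)) (nhds (ENNReal.ofReal (x₃ * x₂))) := by
    have := ENNReal.tendsto_ofReal (hr.tendsto.mono_left (nhdsWithin_le_nhds (s := Set.Ioi 0)))
    simpa using this
  refine ge_of_tendsto ht ?_
  filter_upwards [Ioo_mem_nhdsGT (show (0 : ℝ) < 1 / 2 by norm_num)] with h hh
  obtain ⟨h0, h1⟩ := hh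
  refine (carlesonBellman_le_majorant hI h0 h1.le).trans (le_of_eq ?_)
  congr 1
  have hh' : 0 < 1 - h := by linarith
  have hy : 0 < 1 - h * (1 - x₃) := by nlinarith
  rw [carlesonMajorant, E]
  field_simp
  ring

/-! ### The equation for the parameter -/

/-- This form displays the monotonicity: the subtracted product has nonnegative increasing factors.
It runs from `1` at `a = 0` to `0` at `a = 1/4`. -/
theorem carlesonCubic_iff {x₁ x₂ x₃ a : ℝ} (hx₃ : 0 < x₃) (hx₃' : x₃ ≤ 1)
    (ha : a ∈ Set.Icc (0 : ℝ) (1 / 4)) :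
    CarlesonCubic x₁ x₂ x₃ a ↔ 1 - 4 * x₃ * ((a / (1 - 2 * a)) ^ 2 *
      (1 + (1 - x₃) / (1 - 4 * a * (1 - x₃)))) = x₁ ^ 2 / x₂ := by
  obtain ⟨h0, h1⟩ := ha
  have d1 : 0 < 1 - 2 * a := by linarith
  have d2 : 0 < 1 - 4 * a * (1 - x₃) := by nlinarith
  rw [CarlesonCubic, eq_comm]
  have : ((1 - 2 * a * (1 - x₃)) / (1 - 2 * a)) ^ 2 * ((1 - 4 * a) / (1 - 4 * a * (1 - x₃))) =
      1 - 4 * x₃ * ((a / (1 - 2 * a)) ^ 2 * (1 + (1 - x₃) / (1 - 4 * a * (1 - x₃)))) := by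
    have d3 : 1 - a * (1 - x₃) * 4 ≠ 0 := fun h' => by linarith
    field_simp
    ring
  rw [this]

theorem carlesonCubic_strictAntiOn {x₃ : ℝ} (hx₃ : 0 < x₃) (hx₃' : x₃ ≤ 1) :
    StrictAntiOn (fun a : ℝ => 1 - 4 * x₃ * ((a / (1 - 2 * a)) ^ 2 *
      (1 + (1 - x₃) / (1 - 4 * a * (1 - x₃))))) (Set.Icc 0 (1 / 4)) := by
  rintro a ⟨ha0, ha1⟩ b ⟨hb0, hb1⟩ hab
  have hy : 0 ≤ 1 - x₃ := by linarith
  have da : 0 < 1 - 2 * a := by linarith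
  have db : 0 < 1 - 2 * b := by linarith
  have ea : 0 < 1 - 4 * a * (1 - x₃) := by nlinarith
  have eb : 0 < 1 - 4 * b * (1 - x₃) := by nlinarith
  have h1 : a / (1 - 2 * a) < b / (1 - 2 * b) := by
    rw [div_lt_div_iff₀ da db]
    nlinarith
  have h2 : (a / (1 - 2 * a)) ^ 2 < (b / (1 - 2 * b)) ^ 2 :=
    pow_lt_pow_left₀ h1 (div_nonneg ha0 da.le) two_ne_zero
  have h3 : (1 - x₃) / (1 - 4 * a * (1 - x₃)) ≤ (1 - x₃) / (1 - 4 * b * (1 - x₃)) := by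
    apply div_le_div_of_nonneg_left hy eb
    nlinarith
  have h4 : 0 ≤ (1 - x₃) / (1 - 4 * a * (1 - x₃)) := div_nonneg hy ea.le
  have h5 : (a / (1 - 2 * a)) ^ 2 * (1 + (1 - x₃) / (1 - 4 * a * (1 - x₃))) <
      (b / (1 - 2 * b)) ^ 2 * (1 + (1 - x₃) / (1 - 4 * b * (1 - x₃))) :=
    mul_lt_mul h2 (by linarith) (by linarith) (sq_nonneg _)
  simp only
  nlinarith

theorem exists_carlesonCubic {x₁ x₂ x₃ : ℝ} (hx₂ : 0 < x₂) (hx : x₁ ^ 2 ≤ x₂) (hx₃ : 0 < x₃)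
    (hx₃' : x₃ ≤ 1) : ∃ a ∈ Set.Icc (0 : ℝ) (1 / 4), CarlesonCubic x₁ x₂ x₃ a := by
  have hc : ContinuousOn (fun a : ℝ => 1 - 4 * x₃ * ((a / (1 - 2 * a)) ^ 2 *
      (1 + (1 - x₃) / (1 - 4 * a * (1 - x₃))))) (Set.Icc 0 (1 / 4)) := by
    have n1 : ∀ a ∈ Set.Icc (0 : ℝ) (1 / 4), 1 - 2 * a ≠ 0 := fun a ha => by
      have := ha.2
      intro h
      linarith
    have n2 : ∀ a ∈ Set.Icc (0 : ℝ) (1 / 4), 1 - 4 * a * (1 - x₃) ≠ 0 := fun a ha =>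
      (by nlinarith [ha.1, ha.2] : 0 < 1 - 4 * a * (1 - x₃)).ne'
    fun_prop (disch := assumption)
  have hmem : x₁ ^ 2 / x₂ ∈ Set.Icc (0 : ℝ) 1 := ⟨by positivity, (div_le_one hx₂).2 hx⟩
  have hiv := intermediate_value_Icc' (by norm_num : (0 : ℝ) ≤ 1 / 4) hc
  obtain ⟨a, ha, hav⟩ := hiv (a := x₁ ^ 2 / x₂) (by
    constructor
    · refine le_trans (le_of_eq ?_) hmem.1
      have : 1 - 4 * (1 / 4) * (1 - x₃) = x₃ := by ring
      rw [this]
      field_simp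
      ring
    · refine hmem.2.trans (le_of_eq ?_)
      norm_num)
  exact ⟨a, ha, (carlesonCubic_iff hx₃ hx₃' ha).2 hav⟩

theorem mainTheorem2 (I : ℝ × ℝ) (hI : I.1 < I.2) (x₁ x₂ x₃ : ℝ)
    (hx : x₁ ^ 2 ≤ x₂) (hx₃ : 0 < x₃) (hx₃' : x₃ ≤ 1) :
    (0 < x₂ →
      ∃ a ∈ Set.Icc (0 : ℝ) (1 / 4),
        CarlesonCubic x₁ x₂ x₃ a ∧
        (∀ b ∈ Set.Icc (0 : ℝ) (1 / 4), CarlesonCubic x₁ x₂ x₃ b → b = a) ∧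
        carlesonBellman I x₁ x₂ x₃ =
          ENNReal.ofReal (x₃ * x₂ / ((1 - 2 * a) ^ 2 * (1 - 4 * a * (1 - x₃))))) ∧
    (x₂ = 0 → carlesonBellman I x₁ x₂ x₃ = 0) := by
  constructor
  · intro hx₂
    obtain ⟨a, ha, hA⟩ := exists_carlesonCubic hx₂ hx hx₃ hx₃'
    refine ⟨a, ha, hA, fun b hb hB => ?_, ?_⟩
    · exact (carlesonCubic_strictAntiOn hx₃ hx₃').injOn hb ha
        (((carlesonCubic_iff hx₃ hx₃' hb).1 hB).trans
          ((carlesonCubic_iff hx₃ hx₃' ha).1 hA).symm)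
    obtain ⟨h0, h1⟩ := ha
    have d1 : 0 < 1 - 2 * a := by linarith
    have d2 : 0 < 1 - 4 * a * (1 - x₃) := by nlinarith
    have e : 2 * (2 * a) = 4 * a := by ring
    have E : x₂ * (1 - 2 * (2 * a)) * (1 - 2 * a * (1 - x₃)) ^ 2 =
        x₁ ^ 2 * (1 - 2 * a) ^ 2 * (1 - 2 * (2 * a) * (1 - x₃)) := by
      rw [CarlesonCubic] at hA
      have d3 : 1 - a * (1 - x₃) * 4 ≠ 0 := fun h' => by linarith
      field_simp at hA
      rw [e]
      linarith
    apply le_antisymm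
    · rcases h0.eq_or_lt with rfl | h0
      · have hsq : x₁ ^ 2 = x₂ := by linarith
        simpa using carlesonBellman_le_of_sq_eq hI hx₃ hsq
      · simpa only [e] using
          carlesonBellman_le_of_pos hI (by linarith : 0 < 2 * a) (by linarith) hx₃ E
    · rcases h1.eq_or_lt with rfl | h1
      · have hz : x₁ = 0 := by
          norm_num at E
          rcases E with h | h
          · exact h
          · linarith
        subst hz
        refine le_trans (le_of_eq ?_) (le_carlesonBellman_zero_mean hI hx₂ hx₃ hx₃')
        congr 1
        norm_num
        field_simp
      · have hne : x₁ ≠ 0 := by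
          rintro rfl
          have d3 : 0 < 1 - 2 * (2 * a) := by linarith
          have d4 : 0 < 1 - 2 * a * (1 - x₃) := by nlinarith
          have : 0 < x₂ * (1 - 2 * (2 * a)) * (1 - 2 * a * (1 - x₃)) ^ 2 := by positivity
          rw [E] at this
          simp at this
        simpa only [e] using
          le_carlesonBellman_of_lt hI hne (by linarith : 0 ≤ 2 * a) (by linarith) hx₃ hx₃' E
  · intro hx₂
    have hz : x₁ ^ 2 = x₂ := le_antisymm hx (hx₂ ▸ sq_nonneg x₁)
    simpa [hx₂] using carlesonBellman_le_of_sq_eq hI hx₃ hz
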